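/- Let $M$ be a smooth (Hausdorff, second countable, finite-dimensional, boundaryless) manifold and let $(\omega,\Theta,g)$ be an almost Kähler structure on $M$, that is: $\omega$ is a symplectic form, $\Theta$ is a smooth almost complex structure ($\Theta^2=-\mathrm{Id}$), and $g$ is a Riemannian metric with $g(\Theta X,\Theta Y)=g(X,Y)$ and $\omega(X,Y)=g(\Theta X,Y)$ (so $\dim M$ is even). Two linear connections $\nabla,\nabla^*$ on $M$ are called dual with respect to $g$ if $X\,g(Y,Z)=g(\nabla_XY,Z)+g(Y,\nabla^*_XZ)$ for all vector fields $X,Y,Z$. The almost Kähler manifold is called statistical if there is a pair $(\nabla,\nabla^*)$ of smooth linear connections, dual with respect to $g$ and both torsion-free, such that $\nabla\omega=0$. It is called Kähler if $\Theta$ is integrable, i.e. the Nijenhuis tensor $$N^\Theta(X,Y)=[\Theta X,\Theta Y]-\Theta[\Theta X,Y]-\Theta[X,\Theta Y]+\Theta^2[X,Y]$$ vanishes identically. Let $\nabla^{lc}$ be the Levi-Civita connection of $g$ and let $R^{\nabla^{lc}}(X,Y)Z=\nabla^{lc}_X\nabla^{lc}_YZ-\nabla^{lc}_Y\nabla^{lc}_XZ-\nabla^{lc}_{[X,Y]}Z$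 be its curvature. Then the following statements are equivalent: 1. $(M,\omega,\Theta,g)$ is a statistical almost Kähler manifold; 2. $R^{\nabla^{lc}}(X,Y)\,\Theta Z=\Theta\,R^{\nabla^{lc}}(X,Y)Z$ for all smooth vector fields $X,Y,Z$ on $M$; 3. $(M,\omega,\Theta,g)$ is a Kähler manifold. -/

import Mathlib

open Bundle Manifold
open scoped ContDiff

namespace AlmostKahler

noncomputable section

variable {E : Type*} [NormedAddCommGroup E] [NormedSpace ℝ E] [FiniteDimensional ℝ E]
  {M : Type*} [TopologicalSpace M] [ChartedSpace E M] [IsManifold 𝓘(ℝ, E) ∞ M]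

/-- Vector fields on `M` (no regularity). -/
abbrev VField (E : Type*) [NormedAddCommGroup E] [NormedSpace ℝ E]
    (M : Type*) [TopologicalSpace M] [ChartedSpace E M] : Type _ :=
  (x : M) → TangentSpace 𝓘(ℝ, E) x

/-- A linear connection on `M`: `∇ Y x v` is `(∇_v Y)(x)` for `v ∈ T_x M`. -/
abbrev Connection (E : Type*) [NormedAddCommGroup E] [NormedSpace ℝ E]
    (M : Type*) [TopologicalSpace M] [ChartedSpace E M] [IsManifold 𝓘(ℝ, E) ∞ M] : Type _ :=
  CovariantDerivative 𝓘(ℝ, E) E (TangentSpace 𝓘(ℝ, E) : M → Type _)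

/-- Differentiability at `x` of a vector field. -/
def DiffAt (X : VField E M) (x : M) : Prop :=
  MDifferentiableAt 𝓘(ℝ, E) (𝓘(ℝ, E).prod 𝓘(ℝ, E))
    (fun y ↦ TotalSpace.mk' E (E := (TangentSpace 𝓘(ℝ, E) : M → Type _)) y (X y)) x

/-- Smooth vector fields. -/
def Smooth (X : VField E M) : Prop :=
  ContMDiff 𝓘(ℝ, E) (𝓘(ℝ, E).prod 𝓘(ℝ, E)) ∞
    (fun y ↦ TotalSpace.mk' E (E := (TangentSpace 𝓘(ℝ, E) : M → Type _)) y (X y))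

/-- The derivative of the real function `f` in the direction `v ∈ T_x M`. -/
def dirDeriv (f : M → ℝ) (x : M) (v : TangentSpace 𝓘(ℝ, E) x) : ℝ :=
  mfderiv 𝓘(ℝ, E) 𝓘(ℝ, ℝ) f x v

/-- The Lie bracket of vector fields. -/
def bracket (X Y : VField E M) : VField E M :=
  VectorField.mlieBracket 𝓘(ℝ, E) X Y

/-- A field of endomorphisms of the tangent spaces. -/
abbrev EndField (E : Type*) [NormedAddCommGroup E] [NormedSpace ℝ E]
    (M : Type*) [TopologicalSpace M] [ChartedSpace E M] : Type _ :=
  (x : M) → TangentSpace 𝓘(ℝ, E) x →L[ℝ] TangentSpace 𝓘(ℝ, E) x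

/-- A field of bilinear forms on the tangent spaces. -/
abbrev BilinField (E : Type*) [NormedAddCommGroup E] [NormedSpace ℝ E]
    (M : Type*) [TopologicalSpace M] [ChartedSpace E M] : Type _ :=
  (x : M) → TangentSpace 𝓘(ℝ, E) x →L[ℝ] TangentSpace 𝓘(ℝ, E) x →L[ℝ] ℝ

/-- The vector field `Θ X`. -/
def EndField.app (Θ : EndField E M) (X : VField E M) : VField E M :=
  fun x ↦ Θ x (X x)

/-- `dΩ = 0`, through the invariant formula for `dΩ(X, Y, Z)`. The formula is tensorial on vector
fields that are differentiable at the point, so it may be tested on all of these. -/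
def IsClosedForm (Ω : BilinField E M) : Prop :=
  ∀ (x : M) (X Y Z : VField E M), DiffAt X x → DiffAt Y x → DiffAt Z x →
    dirDeriv (fun y ↦ Ω y (Y y) (Z y)) x (X x)
      - dirDeriv (fun y ↦ Ω y (X y) (Z y)) x (Y x)
      + dirDeriv (fun y ↦ Ω y (X y) (Y y)) x (Z x)
      - Ω x (bracket X Y x) (Z x)
      + Ω x (bracket X Z x) (Y x)
      - Ω x (bracket Y Z x) (X x) = 0

variable (E M) in
/-- An almost Kähler structure `(Ω, Θ, g)` on `M`: a symplectic form `Ω`, an almost complex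
structure `Θ` and a Riemannian metric `g`, with `g(ΘX, ΘY) = g(X, Y)` and `Ω(X, Y) = g(ΘX, Y)`. -/
structure AlmostKahlerStructure where
  /-- the Riemannian metric -/
  g : ContMDiffRiemannianMetric 𝓘(ℝ, E) ∞ E (TangentSpace 𝓘(ℝ, E) : M → Type _)
  /-- the almost complex structure -/
  Θ : EndField E M
  /-- the symplectic form -/
  Ω : BilinField E M
  smooth_Θ : ContMDiff 𝓘(ℝ, E) (𝓘(ℝ, E).prod 𝓘(ℝ, E →L[ℝ] E)) ∞
    (fun x ↦ TotalSpace.mk' (E →L[ℝ] E)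
      (E := fun x : M ↦ TangentSpace 𝓘(ℝ, E) x →L[ℝ] TangentSpace 𝓘(ℝ, E) x) x (Θ x))
  smooth_Ω : ContMDiff 𝓘(ℝ, E) (𝓘(ℝ, E).prod 𝓘(ℝ, E →L[ℝ] E →L[ℝ] ℝ)) ∞
    (fun x ↦ TotalSpace.mk' (E →L[ℝ] E →L[ℝ] ℝ)
      (E := fun x : M ↦ TangentSpace 𝓘(ℝ, E) x →L[ℝ] TangentSpace 𝓘(ℝ, E) x →L[ℝ] ℝ) x (Ω x))
  Θ_sq : ∀ (x : M) (v : TangentSpace 𝓘(ℝ, E) x), Θ x (Θ x v) = -v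
  Ω_alt : ∀ (x : M) (v : TangentSpace 𝓘(ℝ, E) x), Ω x v v = 0
  Ω_nondeg : ∀ (x : M) (v : TangentSpace 𝓘(ℝ, E) x), (∀ w, Ω x v w = 0) → v = 0
  Ω_closed : IsClosedForm Ω
  hermitian : ∀ (x : M) (v w : TangentSpace 𝓘(ℝ, E) x),
    g.inner x (Θ x v) (Θ x w) = g.inner x v w
  compatible : ∀ (x : M) (v w : TangentSpace 𝓘(ℝ, E) x), Ω x v w = g.inner x (Θ x v) w

/-- The connections `∇` and `∇'` are dual with respect to `g`:
`X g(Y, Z) = g(∇_X Y, Z) + g(Y, ∇'_X Z)`. -/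
def AreDual (g : ContMDiffRiemannianMetric 𝓘(ℝ, E) ∞ E (TangentSpace 𝓘(ℝ, E) : M → Type _))
    (nab nab' : Connection E M) : Prop :=
  ∀ (x : M) (v : TangentSpace 𝓘(ℝ, E) x) (Y Z : VField E M), DiffAt Y x → DiffAt Z x →
    dirDeriv (fun y ↦ g.inner y (Y y) (Z y)) x v
      = g.inner x (nab Y x v) (Z x) + g.inner x (Y x) (nab' Z x v)

/-- The bilinear form `Ω` is parallel, `∇Ω = 0`. -/
def IsParallel (nab : Connection E M) (Ω : BilinField E M) : Prop :=
  ∀ (x : M) (v : TangentSpace 𝓘(ℝ, E) x) (Y Z : VField E M), DiffAt Y x → DiffAt Z x →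
    dirDeriv (fun y ↦ Ω y (Y y) (Z y)) x v - Ω x (nab Y x v) (Z x) - Ω x (Y x) (nab Z x v) = 0

/-- A smooth connection: it maps smooth vector fields to smooth tensor fields. -/
def IsSmoothConnection (nab : Connection E M) : Prop :=
  CovariantDerivative.ContMDiffCovariantDerivative nab ∞

/-- Vanishing torsion. -/
def IsTorsionFree (nab : Connection E M) : Prop :=
  nab.torsion = 0

/-- The Levi-Civita connection of `g`: the torsion-free connection that preserves `g`. -/
structure IsLeviCivita
    (g : ContMDiffRiemannianMetric 𝓘(ℝ, E) ∞ E (TangentSpace 𝓘(ℝ, E) : M → Type _))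
    (nab : Connection E M) : Prop where
  smooth : IsSmoothConnection nab
  torsionFree : IsTorsionFree nab
  metric : AreDual g nab nab

/-- The vector field `∇_X Y`. -/
def along (nab : Connection E M) (X Y : VField E M) : VField E M :=
  fun x ↦ nab Y x (X x)

/-- The curvature `R(X, Y)Z = ∇_X ∇_Y Z - ∇_Y ∇_X Z - ∇_{[X, Y]} Z`. -/
def curvature (nab : Connection E M) (X Y Z : VField E M) : VField E M :=
  along nab X (along nab Y Z) - along nab Y (along nab X Z) - along nab (bracket X Y) Z

/-- The pair `(∇, ∇')` belongs to the space of symplectic SMAT connections of the almost Kähler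
structure: dual connections with `∇` torsion-free and `∇Ω = 0`. -/
structure IsSymplecticSMAT (S : AlmostKahlerStructure E M) (nab nab' : Connection E M) : Prop where
  smooth : IsSmoothConnection nab
  smooth' : IsSmoothConnection nab'
  dual : AreDual S.g nab nab'
  torsionFree : IsTorsionFree nab
  parallel : IsParallel nab S.Ω

/-- Statistical connections: dual connections that are both torsion-free. -/
structure IsStatisticalPair
    (g : ContMDiffRiemannianMetric 𝓘(ℝ, E) ∞ E (TangentSpace 𝓘(ℝ, E) : M → Type _))
    (nab nab' : Connection E M) : Prop where
  smooth : IsSmoothConnection nab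
  smooth' : IsSmoothConnection nab'
  dual : AreDual g nab nab'
  torsionFree : IsTorsionFree nab
  torsionFree' : IsTorsionFree nab'

/-- Statistical almost Kähler: among the pairs of symplectic SMAT connections there is a pair of
statistical connections. -/
def IsStatistical (S : AlmostKahlerStructure E M) : Prop :=
  ∃ nab nab' : Connection E M, IsSymplecticSMAT S nab nab' ∧ IsStatisticalPair S.g nab nab'

/-- The curvature of the Levi-Civita connection commutes with `Θ`:
`R(X, Y) ΘZ = Θ R(X, Y) Z` for all smooth vector fields. -/
def LeviCivitaCurvatureCommutes (S : AlmostKahlerStructure E M) : Prop :=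
  ∃ nab : Connection E M, IsLeviCivita S.g nab ∧
    ∀ X Y Z : VField E M, Smooth X → Smooth Y → Smooth Z →
      curvature nab X Y (S.Θ.app Z) = S.Θ.app (curvature nab X Y Z)

/-- The Nijenhuis tensor `[ΘX, ΘY] - Θ[ΘX, Y] - Θ[X, ΘY] + Θ²[X, Y]`. -/
def nijenhuis (Θ : EndField E M) (X Y : VField E M) : VField E M :=
  bracket (Θ.app X) (Θ.app Y) - Θ.app (bracket (Θ.app X) Y) - Θ.app (bracket X (Θ.app Y))
    + Θ.app (Θ.app (bracket X Y))

/-- Kähler: the almost complex structure is integrable, i.e. its Nijenhuis tensor vanishes. -/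
def IsKahler (S : AlmostKahlerStructure E M) : Prop :=
  ∀ X Y : VField E M, Smooth X → Smooth Y → nijenhuis S.Θ X Y = 0

end

end AlmostKahler

/-! Let `∇` be the Levi-Civita connection and `q_v = ∇_v Θ`. The pivot is `inner_nijenhuis`: since
`dΩ = 0`, `g(N(Y, Z), ΘX) = 2 g(q_X Y, Z)`, so `N = 0` exactly when `∇Θ = 0`.

From 3, `∇Θ = 0` makes `(∇, ∇)` a statistical pair with `∇Ω = 0`, and differentiating `∇(ΘZ) = Θ∇Z`
once more shows that the curvature commutes with `Θ`. Both conclusions need `∇` to exist, so it is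
built from the Koszul formula and shown to be smooth.

From 1, duality and `∇Ω = 0` give `∇'Θ = Θ∇` and `∇Θ = Θ∇'` as operators on fields. As both
connections are torsion-free, each bracket in `N` may be expanded with either one, and a suitable
choice makes `N` cancel.

From 2, the hypothesis reads `[∇_W, q_X] - [∇_X, q_W] = q_{[W, X]}`. Together with `q_{Θv} = -Θ q_v`
it forces `q_{N(W, X)} = 0` (`covDerivΘ_nijenhuis`). Putting `X = -ΘN(Y, Z)` in the pivot identity
then gives `|N(Y, Z)|² = 0`. -/

namespace AlmostKahler

noncomputable section

/-! ### Directional derivatives, vector fields and connections -/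

section Fields

variable {E : Type*} [NormedAddCommGroup E] [NormedSpace ℝ E]
  {M : Type*} [TopologicalSpace M] [ChartedSpace E M]

variable {X Y Z : VField E M} {x : M}

theorem dirDeriv_neg (f : M → ℝ) (v : TangentSpace 𝓘(ℝ, E) x) :
    dirDeriv (fun y ↦ -f y) x v = -dirDeriv f x v := by
  have := congrArg (fun L ↦ L v) (mvfderiv_neg (I := 𝓘(ℝ, E)) (g := f) (x := x))
  exact this

theorem dirDeriv_add {f f' : M → ℝ} (hf : MDifferentiableAt 𝓘(ℝ, E) 𝓘(ℝ, ℝ) f x)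
    (hf' : MDifferentiableAt 𝓘(ℝ, E) 𝓘(ℝ, ℝ) f' x) (v : TangentSpace 𝓘(ℝ, E) x) :
    dirDeriv (fun y ↦ f y + f' y) x v = dirDeriv f x v + dirDeriv f' x v := by
  have := congrArg (fun L ↦ L v) (mvfderiv_add (I := 𝓘(ℝ, E)) hf hf')
  exact this

theorem dirDeriv_mul {f f' : M → ℝ} (hf : MDifferentiableAt 𝓘(ℝ, E) 𝓘(ℝ, ℝ) f x)
    (hf' : MDifferentiableAt 𝓘(ℝ, E) 𝓘(ℝ, ℝ) f' x) (v : TangentSpace 𝓘(ℝ, E) x) :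
    dirDeriv (fun y ↦ f y * f' y) x v = f x * dirDeriv f' x v + f' x * dirDeriv f x v := by
  have := congrArg (fun L ↦ L v) (mvfderiv_mul (I := 𝓘(ℝ, E)) hf hf')
  exact this

variable [IsManifold 𝓘(ℝ, E) ∞ M]

theorem Smooth.diffAt (hX : Smooth X) (x : M) : DiffAt X x :=
  (hX x).mdifferentiableAt (by simp)

theorem DiffAt.add (hX : DiffAt X x) (hY : DiffAt Y x) : DiffAt (X + Y) x :=
  mdifferentiableAt_add_section hX hY

theorem DiffAt.smul {f : M → ℝ} (hf : MDifferentiableAt 𝓘(ℝ, E) 𝓘(ℝ, ℝ) f x) (hX : DiffAt X x) :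
    DiffAt (f • X) x :=
  hf.smul_section hX

theorem DiffAt.neg (hX : DiffAt X x) : DiffAt (-X) x :=
  mdifferentiableAt_neg_section hX

theorem Smooth.sub (hX : Smooth X) (hY : Smooth Y) : Smooth (X - Y) :=
  ContMDiff.sub_section hX hY

variable (x) in
theorem exists_smooth_eq [FiniteDimensional ℝ E] [T2Space M] (v : TangentSpace 𝓘(ℝ, E) x) :
    ∃ X : VField E M, Smooth X ∧ X x = v := by
  obtain ⟨s, hs, hsv⟩ := FiberBundle.exists_contMDiffOn_extend (k := ∞) 𝓘(ℝ, E) E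
    (V := (TangentSpace 𝓘(ℝ, E) : M → Type _)) v
  obtain ⟨f, -, hf⟩ := (SmoothBumpFunction.nhds_basis_tsupport (I := 𝓘(ℝ, E)) x).mem_iff.1
    (interior_mem_nhds.2 hs)
  -- The bump function is 1 at `x` and supported where the local extension is smooth, so the product
  -- is globally smooth with the same value at `x`.
  refine ⟨(f : M → ℝ) • FiberBundle.extend E v, ?_, by simp⟩
  exact ContMDiffOn.smul_section_of_tsupport f.contMDiff.contMDiffOn isOpen_interior hf
    (hsv.mono interior_subset)

theorem mdifferentiableAt_inner
    (g : ContMDiffRiemannianMetric 𝓘(ℝ, E) ∞ E (TangentSpace 𝓘(ℝ, E) : M → Type _))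
    (hX : DiffAt X x) (hY : DiffAt Y x) :
    MDifferentiableAt 𝓘(ℝ, E) 𝓘(ℝ, ℝ) (fun y ↦ g.inner y (X y) (Y y)) x := by
  have h : MDifferentiableAt 𝓘(ℝ, E) (𝓘(ℝ, E).prod 𝓘(ℝ, ℝ))
      (fun y ↦ TotalSpace.mk' ℝ (E := Bundle.Trivial M ℝ) y (g.inner y (X y) (Y y))) x :=
    MDifferentiableAt.clm_bundle_apply₂ (F₁ := E) (F₂ := E)
      (g.contMDiff.mdifferentiable (by simp) x) hX hY
  rw [mdifferentiableAt_totalSpace] at h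
  exact h.2

theorem contMDiffAt_inner
    (g : ContMDiffRiemannianMetric 𝓘(ℝ, E) ∞ E (TangentSpace 𝓘(ℝ, E) : M → Type _))
    (hX : ContMDiffAt 𝓘(ℝ, E) (𝓘(ℝ, E).prod 𝓘(ℝ, E)) ∞
      (fun y ↦ TotalSpace.mk' E (E := (TangentSpace 𝓘(ℝ, E) : M → Type _)) y (X y)) x)
    (hY : ContMDiffAt 𝓘(ℝ, E) (𝓘(ℝ, E).prod 𝓘(ℝ, E)) ∞
      (fun y ↦ TotalSpace.mk' E (E := (TangentSpace 𝓘(ℝ, E) : M → Type _)) y (Y y)) x) :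
    ContMDiffAt 𝓘(ℝ, E) 𝓘(ℝ, ℝ) ∞ (fun y ↦ g.inner y (X y) (Y y)) x := by
  have h : ContMDiffAt 𝓘(ℝ, E) (𝓘(ℝ, E).prod 𝓘(ℝ, ℝ)) ∞
      (fun y ↦ TotalSpace.mk' ℝ (E := Bundle.Trivial M ℝ) y (g.inner y (X y) (Y y))) x :=
    ContMDiffAt.clm_bundle_apply₂ (F₁ := E) (F₂ := E) (g.contMDiff x) hX hY
  rw [contMDiffAt_totalSpace] at h
  exact h.2

section Connections

variable (nab : Connection E M)

theorem conn_add (hX : DiffAt X x) (hY : DiffAt Y x) (v : TangentSpace 𝓘(ℝ, E) x) :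
    nab (X + Y) x v = nab X x v + nab Y x v := by
  rw [nab.isCovariantDerivativeOnUniv.add hX hY]; rfl

theorem conn_smul {f : M → ℝ} (hf : MDifferentiableAt 𝓘(ℝ, E) 𝓘(ℝ, ℝ) f x) (hX : DiffAt X x)
    (v : TangentSpace 𝓘(ℝ, E) x) :
    nab (f • X) x v = f x • nab X x v + dirDeriv f x v • X x := by
  rw [nab.isCovariantDerivativeOnUniv.leibniz hX hf]; rfl

theorem conn_neg (hX : DiffAt X x) (v : TangentSpace 𝓘(ℝ, E) x) :
    nab (-X) x v = -nab X x v := by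
  have := nab.isCovariantDerivativeOnUniv.smul_const (-1) hX
  rw [neg_one_smul, neg_one_smul] at this
  rw [this]; rfl

variable {nab}

theorem IsSmoothConnection.along (h : IsSmoothConnection nab) (hX : Smooth X) (hY : Smooth Y) :
    Smooth (along nab X Y) := by
  have h2 := h.contMDiff.contMDiff (σ := Y) (by simpa [contMDiffOn_univ] using! hY)
  rw [contMDiffOn_univ] at h2
  exact ContMDiff.clm_bundle_apply h2 hX

variable [FiniteDimensional ℝ E]

theorem IsTorsionFree.bracket_eq (h : IsTorsionFree nab) (hX : DiffAt X x) (hY : DiffAt Y x) :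
    bracket X Y x = nab Y x (X x) - nab X x (Y x) :=
  ((CovariantDerivative.torsion_eq_zero_iff nab).1 h hX hY).symm

theorem isTorsionFree_iff : IsTorsionFree nab ↔ ∀ {X Y : VField E M} {x : M}, DiffAt X x →
    DiffAt Y x → nab Y x (X x) - nab X x (Y x) = bracket X Y x :=
  CovariantDerivative.torsion_eq_zero_iff nab

end Connections

end Fields

/-! ### The covariant derivative of `Θ` and the Nijenhuis tensor -/

section Structures

variable {E : Type*} [NormedAddCommGroup E] [NormedSpace ℝ E]
  {M : Type*} [TopologicalSpace M] [ChartedSpace E M] [IsManifold 𝓘(ℝ, E) ∞ M]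
  (S : AlmostKahlerStructure E M) {X Y Z : VField E M} {x : M}

theorem DiffAt.app (hX : DiffAt X x) : DiffAt (S.Θ.app X) x :=
  MDifferentiableAt.clm_bundle_apply (S.smooth_Θ.mdifferentiable (by simp) x) hX

theorem Smooth.app (hX : Smooth X) : Smooth (S.Θ.app X) :=
  ContMDiff.clm_bundle_apply S.smooth_Θ hX

theorem app_app (X : VField E M) : S.Θ.app (S.Θ.app X) = -X :=
  funext fun x ↦ S.Θ_sq x (X x)

theorem inner_Θ_left (x : M) (v w : TangentSpace 𝓘(ℝ, E) x) :
    S.g.inner x (S.Θ x v) w = -S.g.inner x v (S.Θ x w) := by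
  rw [← S.hermitian x (S.Θ x v) w, S.Θ_sq]; simp

/-- The covariant derivative of `Θ` in the direction `v`, applied to the field `Y`. -/
def covDerivΘ (nab : Connection E M) (Y : VField E M) (x : M) (v : TangentSpace 𝓘(ℝ, E) x) :
    TangentSpace 𝓘(ℝ, E) x :=
  nab (S.Θ.app Y) x v - S.Θ x (nab Y x v)

theorem eq_zero_of_inner_eq_zero
    (g : ContMDiffRiemannianMetric 𝓘(ℝ, E) ∞ E (TangentSpace 𝓘(ℝ, E) : M → Type _))
    {x : M} {u : TangentSpace 𝓘(ℝ, E) x} (h : ∀ w, g.inner x u w = 0) : u = 0 := by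
  by_contra hu
  exact (g.pos x u hu).ne' (h u)

theorem eq_of_inner_eq
    (g : ContMDiffRiemannianMetric 𝓘(ℝ, E) ∞ E (TangentSpace 𝓘(ℝ, E) : M → Type _))
    {x : M} {u v : TangentSpace 𝓘(ℝ, E) x} (h : ∀ w, g.inner x u w = g.inner x v w) : u = v :=
  sub_eq_zero.1 <| eq_zero_of_inner_eq_zero g fun w ↦ by simp [h w]

variable (x) in
theorem exists_diffAt_eq (v : TangentSpace 𝓘(ℝ, E) x) : ∃ X : VField E M, DiffAt X x ∧ X x = v :=
  ⟨FiberBundle.extend E v, FiberBundle.mdifferentiableAt_extend .., by simp⟩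

variable {S} {nab nab' : Connection E M}

theorem covDerivΘ_neg_dir (v : TangentSpace 𝓘(ℝ, E) x) :
    covDerivΘ S nab Y x (-v) = -covDerivΘ S nab Y x v := by
  simp only [covDerivΘ, map_neg]; abel

theorem covDerivΘ_sub_dir (v w : TangentSpace 𝓘(ℝ, E) x) :
    covDerivΘ S nab Y x (v - w) = covDerivΘ S nab Y x v - covDerivΘ S nab Y x w := by
  simp only [covDerivΘ, map_sub]; abel

theorem covDerivΘ_add_dir (v w : TangentSpace 𝓘(ℝ, E) x) :
    covDerivΘ S nab Y x (v + w) = covDerivΘ S nab Y x v + covDerivΘ S nab Y x w := by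
  simp only [covDerivΘ, map_add]; abel

/-- Covariant derivative of `Θ² = -1`: `q_v` anticommutes with `Θ`. -/
theorem covDerivΘ_app (hY : DiffAt Y x) (v : TangentSpace 𝓘(ℝ, E) x) :
    covDerivΘ S nab (S.Θ.app Y) x v = -S.Θ x (covDerivΘ S nab Y x v) := by
  simp only [covDerivΘ, app_app, conn_neg nab hY, map_sub, S.Θ_sq]
  abel

/-- `Θ` is `g`-skew and `g` is parallel, so `q_v` is again skew. -/
theorem inner_covDerivΘ_swap (h : AreDual S.g nab nab) (hY : DiffAt Y x) (hZ : DiffAt Z x)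
    (v : TangentSpace 𝓘(ℝ, E) x) :
    S.g.inner x (covDerivΘ S nab Y x v) (Z x) = -S.g.inner x (covDerivΘ S nab Z x v) (Y x) := by
  have h1 := h x v _ Z (hY.app S) hZ
  have h2 := h x v _ Y (hZ.app S) hY
  have h3 : (fun y ↦ S.g.inner y (S.Θ.app Y y) (Z y))
      = fun y ↦ -S.g.inner y (S.Θ.app Z y) (Y y) := by
    funext y
    simp only [EndField.app]
    rw [inner_Θ_left, S.g.symm]
  rw [h3, dirDeriv_neg] at h1
  simp only [covDerivΘ, map_sub, sub_apply, inner_Θ_left]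
  simp only [EndField.app, inner_Θ_left] at h1 h2 ⊢
  rw [S.g.symm x (nab Z x v), S.g.symm x (nab Y x v)]
  rw [inner_Θ_left, inner_Θ_left]
  linarith

theorem dirDeriv_Ω (h : AreDual S.g nab nab) (hY : DiffAt Y x) (hZ : DiffAt Z x)
    (v : TangentSpace 𝓘(ℝ, E) x) :
    dirDeriv (fun y ↦ S.Ω y (Y y) (Z y)) x v = S.g.inner x (covDerivΘ S nab Y x v) (Z x)
      + S.Ω x (nab Y x v) (Z x) + S.Ω x (Y x) (nab Z x v) := by
  simp only [S.compatible]
  refine (h x v _ Z (hY.app S) hZ).trans ?_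
  simp [covDerivΘ, EndField.app]

theorem Ω_swap (x : M) (v w : TangentSpace 𝓘(ℝ, E) x) : S.Ω x v w = -S.Ω x w v := by
  rw [S.compatible, S.compatible, inner_Θ_left, S.g.symm]

variable [FiniteDimensional ℝ E]

/-- This is `dΩ = 0` rewritten: for a torsion-free connection the bracket terms absorb all
derivatives of the fields, leaving only the terms in `∇Θ`. -/
theorem cyclic_covDerivΘ (h : AreDual S.g nab nab) (ht : IsTorsionFree nab)
    (hX : DiffAt X x) (hY : DiffAt Y x) (hZ : DiffAt Z x) :
    S.g.inner x (covDerivΘ S nab Y x (X x)) (Z x) + S.g.inner x (covDerivΘ S nab Z x (Y x)) (X x)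
      + S.g.inner x (covDerivΘ S nab X x (Z x)) (Y x) = 0 := by
  have hc := S.Ω_closed x X Y Z hX hY hZ
  rw [dirDeriv_Ω h hY hZ, dirDeriv_Ω h hX hZ, dirDeriv_Ω h hX hY, ht.bracket_eq hX hY,
    ht.bracket_eq hX hZ, ht.bracket_eq hY hZ] at hc
  simp only [map_sub, sub_apply] at hc
  rw [inner_covDerivΘ_swap h hX hZ (Y x)] at hc
  rw [Ω_swap x (Y x), Ω_swap x (X x) (nab Z x (Y x)), Ω_swap x (X x) (nab Y x (Z x))] at hc
  linarith

theorem nijenhuis_eq (ht : IsTorsionFree nab) (hY : DiffAt Y x) (hZ : DiffAt Z x) :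
    nijenhuis S.Θ Y Z x = covDerivΘ S nab Z x (S.Θ x (Y x)) - covDerivΘ S nab Y x (S.Θ x (Z x))
      + S.Θ x (covDerivΘ S nab Y x (Z x)) - S.Θ x (covDerivΘ S nab Z x (Y x)) := by
  have hb : nijenhuis S.Θ Y Z x = bracket (S.Θ.app Y) (S.Θ.app Z) x
      - S.Θ x (bracket (S.Θ.app Y) Z x) - S.Θ x (bracket Y (S.Θ.app Z) x)
      + S.Θ x (S.Θ x (bracket Y Z x)) := rfl
  rw [hb, ht.bracket_eq (hY.app S) (hZ.app S), ht.bracket_eq (hY.app S) hZ,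
    ht.bracket_eq hY (hZ.app S), ht.bracket_eq hY hZ]
  simp only [covDerivΘ, map_sub, S.Θ_sq, EndField.app]
  abel

/-- The Nijenhuis tensor determines the covariant derivative of `Θ`. -/
theorem inner_nijenhuis (h : AreDual S.g nab nab) (ht : IsTorsionFree nab)
    (hX : DiffAt X x) (hY : DiffAt Y x) (hZ : DiffAt Z x) :
    S.g.inner x (nijenhuis S.Θ Y Z x) (S.Θ x (X x))
      = 2 * S.g.inner x (covDerivΘ S nab Y x (X x)) (Z x) := by
  rw [nijenhuis_eq ht hY hZ]
  simp only [map_sub, map_add, sub_apply, add_apply,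
    S.hermitian]
  -- Closedness enters twice, at `(X, Y, Z)` and at `(X, ΘY, ΘZ)`. Skewness and anticommutation with
  -- `Θ` turn the rest into a linear combination.
  have c1 := cyclic_covDerivΘ h ht hX hY hZ
  have c2 := cyclic_covDerivΘ h ht hX (hY.app S) (hZ.app S)
  have e1 := inner_covDerivΘ_swap h hY hX (Z x)
  have e2 := inner_covDerivΘ_swap h hY (hX.app S) (S.Θ x (Z x))
  simp only [covDerivΘ_app hX, covDerivΘ_app hY, covDerivΘ_app hZ, EndField.app, map_neg,
    neg_apply, S.hermitian, inner_Θ_left] at c2 e2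
  linarith

end Structures

/-! ### The implications between the three conditions -/

section Equivalences

variable {E : Type*} [NormedAddCommGroup E] [NormedSpace ℝ E]
  {M : Type*} [TopologicalSpace M] [ChartedSpace E M] [IsManifold 𝓘(ℝ, E) ∞ M]
  {S : AlmostKahlerStructure E M} {W X Y Z : VField E M} {x : M} {nab nab' : Connection E M}

/-- Differentiate `Ω(Y, Z) = g(Z, ΘY)` in two ways, by `∇Ω = 0` and by duality. The terms containing
`∇Z` agree, and comparing the others gives the claim. -/
theorem dual_app_of_isParallel (hd : AreDual S.g nab nab') (hp : IsParallel nab S.Ω)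
    (hY : DiffAt Y x) (v : TangentSpace 𝓘(ℝ, E) x) :
    nab' (S.Θ.app Y) x v = S.Θ x (nab Y x v) := by
  refine eq_of_inner_eq S.g fun w ↦ ?_
  obtain ⟨Z, hZ, rfl⟩ := exists_diffAt_eq x w
  have h1 := hp x v Y Z hY hZ
  have h2 := hd x v Z _ hZ (hY.app S)
  have h3 : (fun y ↦ S.Ω y (Y y) (Z y)) = fun y ↦ S.g.inner y (Z y) (S.Θ.app Y y) := by
    funext y
    rw [S.compatible, S.g.symm, EndField.app]
  rw [h3, S.compatible, S.compatible] at h1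
  simp only [EndField.app] at h1 h2 ⊢
  rw [S.g.symm x (S.Θ x (Y x)), h2] at h1
  rw [S.g.symm]
  linarith

theorem app_of_isParallel (hd : AreDual S.g nab nab') (hp : IsParallel nab S.Ω)
    (hY : DiffAt Y x) (v : TangentSpace 𝓘(ℝ, E) x) :
    nab (S.Θ.app Y) x v = S.Θ x (nab' Y x v) := by
  have h := congrArg (S.Θ x) (dual_app_of_isParallel hd hp (hY.app S) v)
  rw [app_app, conn_neg nab' hY, S.Θ_sq, map_neg] at h
  exact (neg_injective h).symm

/-- The field `(∇_X Θ) Y`. -/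
def covDerivΘField (S : AlmostKahlerStructure E M) (nab : Connection E M) (X Y : VField E M) :
    VField E M :=
  fun x ↦ covDerivΘ S nab Y x (X x)

theorem smooth_covDerivΘField (hs : IsSmoothConnection nab) (hX : Smooth X) (hY : Smooth Y) :
    Smooth (covDerivΘField S nab X Y) :=
  (hs.along hX (hY.app S)).sub ((hs.along hX hY).app S)

theorem conn_app (Y : VField E M) (x : M) (v : TangentSpace 𝓘(ℝ, E) x) :
    nab (S.Θ.app Y) x v = covDerivΘ S nab Y x v + S.Θ x (nab Y x v) := by
  simp [covDerivΘ]

theorem tensorialAt_covDerivΘ (v : TangentSpace 𝓘(ℝ, E) x) :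
    TensorialAt 𝓘(ℝ, E) E (fun Y : VField E M ↦ covDerivΘ S nab Y x v) x where
  smul {f Y} hf hY := by
    have e : S.Θ.app (f • Y) = f • S.Θ.app Y := by
      funext y; simp [EndField.app]
    simp only [covDerivΘ]
    rw [e, conn_smul nab hf (DiffAt.app S hY), conn_smul nab hf hY]
    simp only [map_add, map_smul, EndField.app, smul_sub]
    abel
  add {Y Z} hY hZ := by
    have e : S.Θ.app (Y + Z) = S.Θ.app Y + S.Θ.app Z := by
      funext y; simp [EndField.app]
    simp only [covDerivΘ]
    rw [e, conn_add nab (DiffAt.app S hY) (DiffAt.app S hZ), conn_add nab hY hZ, map_add]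
    abel

/-- If the curvature commutes with `Θ`, then `[∇_W, ∇_X Θ] - [∇_X, ∇_W Θ] = ∇_{[W, X]} Θ`. -/
theorem commutator_covDerivΘ (hs : IsSmoothConnection nab)
    (hW : Smooth W) (hX : Smooth X) (hY : Smooth Y)
    (hc : curvature nab W X (S.Θ.app Y) = S.Θ.app (curvature nab W X Y)) (x : M) :
    covDerivΘ S nab Y x (bracket W X x) =
      nab (covDerivΘField S nab X Y) x (W x) + covDerivΘ S nab (along nab X Y) x (W x)
      - nab (covDerivΘField S nab W Y) x (X x) - covDerivΘ S nab (along nab W Y) x (X x) := by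
  have hA (X : VField E M) : along nab X (S.Θ.app Y)
      = covDerivΘField S nab X Y + S.Θ.app (along nab X Y) := by
    funext y
    exact conn_app Y y (X y)
  have hc' := congrFun hc x
  -- Move `Θ` to the left through both derivatives. The term with `Θ` outermost reproduces `Θ R` and
  -- cancels.
  have h1 (X W : VField E M) (hX : Smooth X) : nab (along nab X (S.Θ.app Y)) x (W x)
      = nab (covDerivΘField S nab X Y) x (W x) + (covDerivΘ S nab (along nab X Y) x (W x)
        + S.Θ x (nab (along nab X Y) x (W x))) := by
    rw [hA, conn_add nab ((smooth_covDerivΘField hs hX hY).diffAt x)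
      (((hs.along hX hY).app S).diffAt x), conn_app]
  change nab (along nab X (S.Θ.app Y)) x (W x) - nab (along nab W (S.Θ.app Y)) x (X x)
    - nab (S.Θ.app Y) x (bracket W X x) = S.Θ x (nab (along nab X Y) x (W x)
      - nab (along nab W Y) x (X x) - nab Y x (bracket W X x)) at hc'
  rw [h1 X W hX, h1 W X hW, conn_app, map_sub, map_sub] at hc'
  rw [← sub_eq_zero] at hc' ⊢
  rw [← neg_eq_zero, ← hc']
  abel

variable [FiniteDimensional ℝ E]

theorem isKahler_of_isStatistical (h : IsStatistical S) : IsKahler S := by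
  obtain ⟨nab, nab', h1, h2⟩ := h
  intro X Y hX hY
  funext x
  have hb : nijenhuis S.Θ X Y x = bracket (S.Θ.app X) (S.Θ.app Y) x
      - S.Θ x (bracket (S.Θ.app X) Y x) - S.Θ x (bracket X (S.Θ.app Y) x)
      + S.Θ x (S.Θ x (bracket X Y x)) := rfl
  replace hX := hX.diffAt x
  replace hY := hY.diffAt x
  -- Use `∇` for `[ΘX, ΘY]` and `[X, Y]`, but `∇'` for the two mixed brackets. Since passing `Θ`
  -- exchanges the connections, all terms then match.
  rw [hb, h2.torsionFree.bracket_eq (hX.app S) (hY.app S),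
    h2.torsionFree'.bracket_eq (hX.app S) hY, h2.torsionFree'.bracket_eq hX (hY.app S),
    h2.torsionFree.bracket_eq hX hY]
  simp only [app_of_isParallel h1.dual h1.parallel hX, app_of_isParallel h1.dual h1.parallel hY,
    dual_app_of_isParallel h1.dual h1.parallel hX, dual_app_of_isParallel h1.dual h1.parallel hY,
    map_sub, S.Θ_sq, EndField.app, Pi.zero_apply]
  abel

theorem nijenhuis_app_right (ht : IsTorsionFree nab) (hY : DiffAt Y x) (hZ : DiffAt Z x) :
    nijenhuis S.Θ Y (S.Θ.app Z) x = -S.Θ x (nijenhuis S.Θ Y Z x) := by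
  rw [nijenhuis_eq ht hY hZ, nijenhuis_eq ht hY (hZ.app S)]
  simp only [covDerivΘ_app hZ, EndField.app, S.Θ_sq, map_sub, map_add, map_neg, covDerivΘ_neg_dir]
  abel

/-- On an almost Kähler manifold, `∇_{Θv} Θ = -Θ ∇_v Θ`. -/
theorem covDerivΘ_Θ_dir (h : AreDual S.g nab nab) (ht : IsTorsionFree nab) (hY : DiffAt Y x)
    (v : TangentSpace 𝓘(ℝ, E) x) :
    covDerivΘ S nab Y x (S.Θ x v) = -S.Θ x (covDerivΘ S nab Y x v) := by
  refine eq_of_inner_eq S.g fun w ↦ ?_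
  obtain ⟨Z, hZ, rfl⟩ := exists_diffAt_eq x w
  obtain ⟨X, hX, rfl⟩ := exists_diffAt_eq x v
  -- Both identities have left side `-g(N(Y, Z), X)`, the second because `N(Y, ΘZ) = -ΘN(Y, Z)`.
  have h1 := inner_nijenhuis h ht (hX.app S) hY hZ
  have h2 := inner_nijenhuis h ht hX hY (hZ.app S)
  rw [nijenhuis_app_right ht hY hZ] at h2
  simp only [EndField.app, map_neg, neg_apply, S.hermitian, S.Θ_sq] at h1 h2
  rw [map_neg, neg_apply, inner_Θ_left]
  linarith

/-- By `q_{Θv} = -Θ q_v` the left side is `q_{[ΘW,ΘX]} + Θ q_{[ΘW,X]} + Θ q_{[W,ΘX]} - q_{[W,X]}`.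
Insert the commutator formula in each term and use `[∇_W, q_{ΘX}] = -q_W q_X - Θ[∇_W, q_X]`. The
commutators and the quadratic terms cancel separately. -/
theorem covDerivΘ_nijenhuis (hL : IsLeviCivita S.g nab)
    (hc : ∀ X Y Z : VField E M, Smooth X → Smooth Y → Smooth Z →
      curvature nab X Y (S.Θ.app Z) = S.Θ.app (curvature nab X Y Z))
    (hW : Smooth W) (hX : Smooth X) (hY : Smooth Y) (x : M) :
    covDerivΘ S nab Y x (nijenhuis S.Θ W X x) = 0 := by
  have hb : nijenhuis S.Θ W X x = bracket (S.Θ.app W) (S.Θ.app X) x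
      - S.Θ x (bracket (S.Θ.app W) X x) - S.Θ x (bracket W (S.Θ.app X) x)
      + S.Θ x (S.Θ x (bracket W X x)) := rfl
  have hq {Y : VField E M} (hY : Smooth Y) (v : TangentSpace 𝓘(ℝ, E) x) :=
    covDerivΘ_Θ_dir hL.metric hL.torsionFree (hY.diffAt x) v
  have hF (X : VField E M) : covDerivΘField S nab (S.Θ.app X) Y
      = -S.Θ.app (covDerivΘField S nab X Y) := by
    funext y
    exact covDerivΘ_Θ_dir hL.metric hL.torsionFree (hY.diffAt y) (X y)
  have hn {X : VField E M} (hX : Smooth X) (v : TangentSpace 𝓘(ℝ, E) x) :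
      nab (covDerivΘField S nab (S.Θ.app X) Y) x v
        = -(covDerivΘ S nab (covDerivΘField S nab X Y) x v
          + S.Θ x (nab (covDerivΘField S nab X Y) x v)) := by
    rw [hF, conn_neg nab (((smooth_covDerivΘField hL.smooth hX hY).app S).diffAt x), conn_app]
  have hs := hL.smooth
  rw [hb, covDerivΘ_add_dir, covDerivΘ_sub_dir, covDerivΘ_sub_dir, S.Θ_sq, covDerivΘ_neg_dir,
    hq hY, hq hY, commutator_covDerivΘ hs hW hX hY (hc _ _ _ hW hX hY),
    commutator_covDerivΘ hs (hW.app S) hX hY (hc _ _ _ (hW.app S) hX hY),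
    commutator_covDerivΘ hs hW (hX.app S) hY (hc _ _ _ hW (hX.app S) hY),
    commutator_covDerivΘ hs (hW.app S) (hX.app S) hY (hc _ _ _ (hW.app S) (hX.app S) hY)]
  have e (X : VField E M) : S.Θ.app X x = S.Θ x (X x) := rfl
  have eD {X : VField E M} (hX : Smooth X) :
      covDerivΘField S nab X Y x = covDerivΘ S nab Y x (X x) := rfl
  rw [hn hX, hn hX, hn hW, hn hW, e W, e X, hq (hs.along hX hY), hq (hs.along hW hY),
    hq (hs.along (hX.app S) hY), hq (hs.along (hW.app S) hY),
    hq (smooth_covDerivΘField hs hX hY), hq (smooth_covDerivΘField hs hW hY)]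
  simp only [map_sub, map_add, map_neg, S.Θ_sq]
  abel

theorem isKahler_of_leviCivitaCurvatureCommutes (h : LeviCivitaCurvatureCommutes S) :
    IsKahler S := by
  obtain ⟨nab, hL, hc⟩ := h
  intro Y Z hY hZ
  funext x
  set u := nijenhuis S.Θ Y Z x with hu
  -- Chosen so that `ΘX = u` at `x`: the left side of `inner_nijenhuis` becomes `g(u, u)`, the right
  -- side a multiple of `g(Θ q_u Y, Z) = 0`.
  obtain ⟨X, hX, hXu⟩ := exists_diffAt_eq x (-S.Θ x u)
  have h1 := inner_nijenhuis hL.metric hL.torsionFree hX (hY.diffAt x) (hZ.diffAt x)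
  rw [hXu, covDerivΘ_neg_dir, covDerivΘ_Θ_dir hL.metric hL.torsionFree (hY.diffAt x),
    map_neg, S.Θ_sq, ← hu, covDerivΘ_nijenhuis hL hc hY hZ hY x] at h1
  by_contra hne
  refine (S.g.pos x u hne).ne' ?_
  simpa using h1

variable [T2Space M]

theorem covDerivΘ_eq_zero (hL : IsLeviCivita S.g nab) (hK : IsKahler S) (hY : DiffAt Y x)
    (v : TangentSpace 𝓘(ℝ, E) x) : covDerivΘ S nab Y x v = 0 := by
  obtain ⟨Y', hY', he⟩ := exists_smooth_eq x (Y x)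
  -- The Kähler condition only tests smooth fields. Tensoriality allows `Y` to be replaced by a
  -- smooth field with the same value at `x`.
  have h := (tensorialAt_covDerivΘ (S := S) (nab := nab) v).pointwise hY (hY'.diffAt x) he.symm
  refine h.trans (eq_zero_of_inner_eq_zero S.g fun w ↦ ?_)
  obtain ⟨Z, hZ, rfl⟩ := exists_smooth_eq x w
  obtain ⟨X, hX, rfl⟩ := exists_smooth_eq x v
  have h1 := inner_nijenhuis hL.metric hL.torsionFree (hX.diffAt x) (hY'.diffAt x) (hZ.diffAt x)
  rw [hK Y' Z hY' hZ] at h1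
  simpa using h1.symm

theorem isStatistical_of_isKahler (hL : IsLeviCivita S.g nab) (hK : IsKahler S) :
    IsStatistical S := by
  refine ⟨nab, nab, ⟨hL.smooth, hL.smooth, hL.metric, hL.torsionFree, ?_⟩,
    ⟨hL.smooth, hL.smooth, hL.metric, hL.torsionFree, hL.torsionFree⟩⟩
  intro x v Y Z hY hZ
  rw [dirDeriv_Ω hL.metric hY hZ, covDerivΘ_eq_zero hL hK hY]
  simp

theorem leviCivitaCurvatureCommutes_of_isKahler (hL : IsLeviCivita S.g nab) (hK : IsKahler S) :
    LeviCivitaCurvatureCommutes S := by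
  refine ⟨nab, hL, fun X Y Z hX hY hZ ↦ ?_⟩
  have h (W Z : VField E M) (hZ : Smooth Z) :
      along nab W (S.Θ.app Z) = S.Θ.app (along nab W Z) := by
    funext x
    exact sub_eq_zero.1 (covDerivΘ_eq_zero hL hK (hZ.diffAt x) (W x))
  simp only [curvature]
  rw [h Y Z hZ, h X Z hZ, h _ Z hZ, h _ _ (hL.smooth.along hX hZ), h _ _ (hL.smooth.along hY hZ)]
  funext x
  simp [EndField.app]

end Equivalences

/-! ### The Koszul expression and its tensoriality -/

section Koszul

variable {E : Type*} [NormedAddCommGroup E] [NormedSpace ℝ E]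
  {M : Type*} [TopologicalSpace M] [ChartedSpace E M] {x : M}

theorem dirDeriv_add_dir (f : M → ℝ) (x : M) (v w : TangentSpace 𝓘(ℝ, E) x) :
    dirDeriv f x (v + w) = dirDeriv f x v + dirDeriv f x w :=
  (mvfderiv 𝓘(ℝ, E) f x).map_add v w

theorem dirDeriv_smul_dir (f : M → ℝ) (x : M) (c : ℝ) (v : TangentSpace 𝓘(ℝ, E) x) :
    dirDeriv f x (c • v) = c * dirDeriv f x v :=
  (mvfderiv 𝓘(ℝ, E) f x).map_smul c v

variable [IsManifold 𝓘(ℝ, E) ∞ M]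
  (g : ContMDiffRiemannianMetric 𝓘(ℝ, E) ∞ E (TangentSpace 𝓘(ℝ, E) : M → Type _))
  {X X' Y Z Z' : VField E M}

/-- The Koszul expression for `2 g(∇_X Y, Z)`. -/
def koszul (Y X Z : VField E M) (x : M) : ℝ :=
  dirDeriv (fun y ↦ g.inner y (Y y) (Z y)) x (X x)
    + dirDeriv (fun y ↦ g.inner y (X y) (Z y)) x (Y x)
    - dirDeriv (fun y ↦ g.inner y (X y) (Y y)) x (Z x) + g.inner x (bracket X Y x) (Z x)
    - g.inner x (bracket X Z x) (Y x) - g.inner x (bracket Y Z x) (X x)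

variable {g}

theorem koszul_sub_swap (Y X Z : VField E M) (x : M) :
    koszul g Y X Z x - koszul g X Y Z x = 2 * g.inner x (bracket X Y x) (Z x) := by
  have h : bracket Y X x = -bracket X Y x := VectorField.mlieBracket_swap_apply
  simp only [koszul, h, map_neg, neg_apply]
  simp only [g.symm _ (Y _) (X _)]
  ring

theorem koszul_add_swap (Y X Z : VField E M) (x : M) :
    koszul g Y X Z x + koszul g Z X Y x
      = 2 * dirDeriv (fun y ↦ g.inner y (Y y) (Z y)) x (X x) := by
  have h : bracket Z Y x = -bracket Y Z x := VectorField.mlieBracket_swap_apply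
  simp only [koszul, h, map_neg, neg_apply]
  simp only [g.symm _ (Z _) (Y _)]
  ring

theorem dirDeriv_inner_smul_left {f : M → ℝ} (hf : MDifferentiableAt 𝓘(ℝ, E) 𝓘(ℝ, ℝ) f x)
    (hX : DiffAt X x) (hY : DiffAt Y x) (v : TangentSpace 𝓘(ℝ, E) x) :
    dirDeriv (fun y ↦ g.inner y ((f • X) y) (Y y)) x v =
      f x * dirDeriv (fun y ↦ g.inner y (X y) (Y y)) x v
        + g.inner x (X x) (Y x) * dirDeriv f x v := by
  rw [← dirDeriv_mul hf (mdifferentiableAt_inner g hX hY)]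
  simp

theorem dirDeriv_inner_smul_right {f : M → ℝ} (hf : MDifferentiableAt 𝓘(ℝ, E) 𝓘(ℝ, ℝ) f x)
    (hX : DiffAt X x) (hY : DiffAt Y x) (v : TangentSpace 𝓘(ℝ, E) x) :
    dirDeriv (fun y ↦ g.inner y (X y) ((f • Y) y)) x v =
      f x * dirDeriv (fun y ↦ g.inner y (X y) (Y y)) x v
        + g.inner x (X x) (Y x) * dirDeriv f x v := by
  rw [← dirDeriv_mul hf (mdifferentiableAt_inner g hX hY)]
  simp

theorem dirDeriv_inner_add_left (hX : DiffAt X x) (hX' : DiffAt X' x) (hY : DiffAt Y x)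
    (v : TangentSpace 𝓘(ℝ, E) x) :
    dirDeriv (fun y ↦ g.inner y ((X + X') y) (Y y)) x v =
      dirDeriv (fun y ↦ g.inner y (X y) (Y y)) x v
        + dirDeriv (fun y ↦ g.inner y (X' y) (Y y)) x v := by
  rw [← dirDeriv_add (mdifferentiableAt_inner g hX hY) (mdifferentiableAt_inner g hX' hY)]
  simp

theorem dirDeriv_inner_add_right (hX : DiffAt X x) (hY : DiffAt Y x) (hZ : DiffAt Z x)
    (v : TangentSpace 𝓘(ℝ, E) x) :
    dirDeriv (fun y ↦ g.inner y (X y) ((Y + Z) y)) x v =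
      dirDeriv (fun y ↦ g.inner y (X y) (Y y)) x v
        + dirDeriv (fun y ↦ g.inner y (X y) (Z y)) x v := by
  rw [← dirDeriv_add (mdifferentiableAt_inner g hX hY) (mdifferentiableAt_inner g hX hZ)]
  simp

variable [CompleteSpace E]

theorem bracket_smul_right {f : M → ℝ} (hf : MDifferentiableAt 𝓘(ℝ, E) 𝓘(ℝ, ℝ) f x)
    (hY : DiffAt Y x) :
    bracket X (f • Y) x = dirDeriv f x (X x) • Y x + f x • bracket X Y x :=
  VectorField.mlieBracket_smul_right hf hY

theorem bracket_smul_left {f : M → ℝ} (hf : MDifferentiableAt 𝓘(ℝ, E) 𝓘(ℝ, ℝ) f x)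
    (hX : DiffAt X x) :
    bracket (f • X) Y x = -dirDeriv f x (Y x) • X x + f x • bracket X Y x :=
  VectorField.mlieBracket_smul_left hf hX

theorem bracket_add_right (hY : DiffAt Y x) (hZ : DiffAt Z x) :
    bracket X (Y + Z) x = bracket X Y x + bracket X Z x :=
  VectorField.mlieBracket_add_right hY hZ

theorem bracket_add_left (hX : DiffAt X x) (hY : DiffAt Y x) :
    bracket (X + Y) Z x = bracket X Z x + bracket Y Z x :=
  VectorField.mlieBracket_add_left hX hY

variable (g) in
-- The derivatives of `f` coming from the metric terms cancel those coming from the brackets.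
theorem koszul_tensorial_left (hY : DiffAt Y x) (hZ : DiffAt Z x) :
    TensorialAt 𝓘(ℝ, E) E (fun X : VField E M ↦ koszul g Y X Z x) x where
  smul {f X} hf hX := by
    change DiffAt X x at hX
    simp only [koszul, bracket_smul_left hf hX, dirDeriv_inner_smul_left hf hX hZ,
      dirDeriv_inner_smul_left hf hX hY]
    simp [dirDeriv_smul_dir]
    ring
  add {X X'} hX hX' := by
    change DiffAt X x at hX
    change DiffAt X' x at hX'
    simp only [koszul, bracket_add_left hX hX', dirDeriv_inner_add_left hX hX' hZ,
      dirDeriv_inner_add_left hX hX' hY]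
    simp [dirDeriv_add_dir]
    ring

variable (g) in
theorem koszul_tensorial_right (hY : DiffAt Y x) (hX : DiffAt X x) :
    TensorialAt 𝓘(ℝ, E) E (fun Z : VField E M ↦ koszul g Y X Z x) x where
  smul {f Z} hf hZ := by
    change DiffAt Z x at hZ
    simp only [koszul, bracket_smul_right hf hZ, dirDeriv_inner_smul_right hf hX hZ,
      dirDeriv_inner_smul_right hf hY hZ]
    simp [dirDeriv_smul_dir]
    rw [g.symm x (Z x) (Y x), g.symm x (Z x) (X x)]
    ring
  add {Z Z'} hZ hZ' := by
    change DiffAt Z x at hZ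
    change DiffAt Z' x at hZ'
    simp only [koszul, bracket_add_right hZ hZ', dirDeriv_inner_add_right hX hZ hZ',
      dirDeriv_inner_add_right hY hZ hZ']
    simp [dirDeriv_add_dir]
    ring

theorem koszul_add {Y'} (hX : DiffAt X x) (hY : DiffAt Y x) (hY' : DiffAt Y' x)
    (hZ : DiffAt Z x) : koszul g (Y + Y') X Z x = koszul g Y X Z x + koszul g Y' X Z x := by
  simp only [koszul, bracket_add_right hY hY', bracket_add_left hY hY',
    dirDeriv_inner_add_right hX hY hY', dirDeriv_inner_add_left hY hY' hZ]
  simp [dirDeriv_add_dir]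
  ring

/-- The surplus arises once from the first metric term and once from `[X, fY]`. After halving it is
the Leibniz term of a connection. -/
theorem koszul_smul {f : M → ℝ} (hf : MDifferentiableAt 𝓘(ℝ, E) 𝓘(ℝ, ℝ) f x) (hX : DiffAt X x)
    (hY : DiffAt Y x) (hZ : DiffAt Z x) :
    koszul g (f • Y) X Z x
      = f x * koszul g Y X Z x + 2 * (dirDeriv f x (X x) * g.inner x (Y x) (Z x)) := by
  simp only [koszul, bracket_smul_right hf hY, bracket_smul_left hf hY,
    dirDeriv_inner_smul_right hf hX hY, dirDeriv_inner_smul_left hf hY hZ]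
  simp [dirDeriv_smul_dir]
  rw [g.symm x (Y x) (X x)]
  ring

end Koszul

/-! ### Inverting a positive bilinear form -/

section Riesz

variable {V : Type*} [NormedAddCommGroup V] [NormedSpace ℝ V] [FiniteDimensional ℝ V]

theorem isInvertible_of_pos {B : V →L[ℝ] V →L[ℝ] ℝ} (hB : ∀ v, v ≠ 0 → 0 < B v v) :
    B.IsInvertible := by
  have hi : Function.Injective B := by
    refine (injective_iff_map_eq_zero B).2 fun v hv ↦ ?_
    by_contra h
    exact (hB v h).ne' (by simp [hv])
  have hd : Module.finrank ℝ V = Module.finrank ℝ (V →L[ℝ] ℝ) := by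
    rw [← (LinearMap.toContinuousLinearMap (𝕜 := ℝ) (E := V) (F' := ℝ)).finrank_eq]
    exact (Subspace.dual_finrank_eq (K := ℝ) (V := V)).symm
  refine ⟨(LinearEquiv.ofInjectiveOfFinrankEq B.toLinearMap hi hd).toContinuousLinearEquiv, ?_⟩
  ext v w
  rfl

end Riesz

/-! ### Existence of the Levi-Civita connection -/

section LeviCivita

variable {E : Type*} [NormedAddCommGroup E] [NormedSpace ℝ E] [FiniteDimensional ℝ E]
  {M : Type*} [TopologicalSpace M] [ChartedSpace E M] [IsManifold 𝓘(ℝ, E) ∞ M]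
  (g : ContMDiffRiemannianMetric 𝓘(ℝ, E) ∞ E (TangentSpace 𝓘(ℝ, E) : M → Type _))
  {X Y Z : VField E M} {x : M}

theorem isInvertible_inner (x : M) : (g.inner x).IsInvertible :=
  isInvertible_of_pos (V := E) (B := g.inner x) (g.pos x)

open scoped Classical in
/-- The operator underlying the Levi-Civita connection. -/
def leviCivitaFun (Y : VField E M) (x : M) :
    TangentSpace 𝓘(ℝ, E) x →L[ℝ] TangentSpace 𝓘(ℝ, E) x :=
  haveI : CompleteSpace E := FiniteDimensional.complete ℝ E
  if hY : DiffAt Y x then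
    (g.inner x).inverse ∘L ((1 / 2 : ℝ) • TensorialAt.mkHom₂ (I := 𝓘(ℝ, E)) (F := E) (F' := E)
      (fun X Z ↦ koszul g Y X Z x) x
      (fun _ hZ ↦ koszul_tensorial_left g hY hZ) (fun _ hX ↦ koszul_tensorial_right g hY hX))
  -- Harmless default: the connection axioms only concern fields differentiable at the point.
  else 0

theorem inner_leviCivitaFun (hX : DiffAt X x) (hY : DiffAt Y x) (hZ : DiffAt Z x) :
    2 * g.inner x (leviCivitaFun g Y x (X x)) (Z x) = koszul g Y X Z x := by
  have : CompleteSpace E := FiniteDimensional.complete ℝ E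
  have h (φ) : g.inner x ((g.inner x).inverse φ) = φ :=
    (isInvertible_inner g x).self_apply_inverse φ
  rw [leviCivitaFun, dif_pos hY, ContinuousLinearMap.comp_apply, h, smul_apply, smul_apply]
  rw [TensorialAt.mkHom₂_apply _ _ hX hZ]
  simp

/-- The Levi-Civita connection. -/
def leviCivita : Connection E M where
  toFun := leviCivitaFun g
  isCovariantDerivativeOnUniv :=
    { add := by
        intro Y Y' x hY hY' _
        have : CompleteSpace E := FiniteDimensional.complete ℝ E
        ext v
        obtain ⟨X, hX, rfl⟩ := exists_diffAt_eq x v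
        refine eq_of_inner_eq g fun w ↦ ?_
        obtain ⟨Z, hZ, rfl⟩ := exists_diffAt_eq x w
        have h1 := inner_leviCivitaFun g hX hY hZ
        have h2 := inner_leviCivitaFun g hX hY' hZ
        have h3 := inner_leviCivitaFun g hX (DiffAt.add hY hY') hZ
        rw [koszul_add hX hY hY' hZ] at h3
        simp only [add_apply, map_add]
        linarith
      leibniz := by
        intro Y f x hY hf _
        have : CompleteSpace E := FiniteDimensional.complete ℝ E
        ext v
        obtain ⟨X, hX, rfl⟩ := exists_diffAt_eq x v
        refine eq_of_inner_eq g fun w ↦ ?_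
        obtain ⟨Z, hZ, rfl⟩ := exists_diffAt_eq x w
        have h1 := inner_leviCivitaFun g hX hY hZ
        have h3 := inner_leviCivitaFun g hX (DiffAt.smul hf hY) hZ
        rw [koszul_smul hf hX hY hZ, ← h1] at h3
        change _ = g.inner x (f x • leviCivitaFun g Y x (X x) + dirDeriv f x (X x) • Y x) (Z x)
        simp only [add_apply, map_add, map_smul, smul_apply, smul_eq_mul]
        linarith }

theorem inner_leviCivita (hX : DiffAt X x) (hY : DiffAt Y x) (hZ : DiffAt Z x) :
    2 * g.inner x (leviCivita g Y x (X x)) (Z x) = koszul g Y X Z x :=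
  inner_leviCivitaFun g hX hY hZ

theorem isTorsionFree_leviCivita : IsTorsionFree (leviCivita g) := by
  rw [isTorsionFree_iff]
  intro X Y x hX hY
  refine eq_of_inner_eq g fun w ↦ ?_
  obtain ⟨Z, hZ, rfl⟩ := exists_diffAt_eq x w
  have h := koszul_sub_swap (g := g) Y X Z x
  rw [← inner_leviCivita g hX hY hZ, ← inner_leviCivita g hY hX hZ] at h
  rw [map_sub, sub_apply]
  linarith

theorem areDual_leviCivita : AreDual g (leviCivita g) (leviCivita g) := by
  intro x v Y Z hY hZ
  obtain ⟨X, hX, rfl⟩ := exists_diffAt_eq x v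
  have h := koszul_add_swap (g := g) Y X Z x
  rw [← inner_leviCivita g hX hY hZ, ← inner_leviCivita g hX hZ hY] at h
  rw [g.symm x (Y x)]
  linarith

end LeviCivita

/-! ### Smoothness of the Koszul expression -/

section SmoothCoordinates

variable {E : Type*} [NormedAddCommGroup E] [NormedSpace ℝ E]
  {M : Type*} [TopologicalSpace M] [ChartedSpace E M] {x : M}

theorem contMDiffAt_clm_of_apply {V G : Type*} [NormedAddCommGroup V] [NormedSpace ℝ V]
    [FiniteDimensional ℝ V] [NormedAddCommGroup G] [NormedSpace ℝ G] {n : ℕ∞ω}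
    {A : M → V →L[ℝ] G} (h : ∀ v, ContMDiffAt 𝓘(ℝ, E) 𝓘(ℝ, G) n (fun y ↦ A y v) x) :
    ContMDiffAt 𝓘(ℝ, E) 𝓘(ℝ, V →L[ℝ] G) n A x := by
  let b := Module.finBasis ℝ V
  have e : A = fun y ↦ ∑ i, ContinuousLinearMap.smulRightL ℝ V G
      (b.coord i).toContinuousLinearMap (A y (b i)) := by
    funext y
    ext v
    conv_lhs => rw [← b.sum_repr v, map_sum]
    simp [sum_apply]
  rw [e]
  refine contMDiffAt_finsetSum fun i _ ↦ ?_
  exact (ContinuousLinearMap.contMDiff _).contMDiffAt.comp x (h (b i))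

variable [IsManifold 𝓘(ℝ, E) ∞ M]

/-- Smoothness of a vector field at a point. -/
def SmoothAt (X : VField E M) (x : M) : Prop :=
  ContMDiffAt 𝓘(ℝ, E) (𝓘(ℝ, E).prod 𝓘(ℝ, E)) ∞
    (fun y ↦ TotalSpace.mk' E (E := (TangentSpace 𝓘(ℝ, E) : M → Type _)) y (X y)) x

variable {X Y Z : VField E M}

theorem SmoothAt.diffAt (hX : SmoothAt X x) : DiffAt X x :=
  hX.mdifferentiableAt (by simp)

/-- These fields are constant in the trivialization at `x₀`. They serve as a smooth local frame on
which bilinear forms are tested. -/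
theorem smoothAt_symm {x₀ : M}
    (hx : x ∈ (trivializationAt E (TangentSpace 𝓘(ℝ, E) : M → Type _) x₀).baseSet) (v : E) :
    SmoothAt (fun y ↦ (trivializationAt E (TangentSpace 𝓘(ℝ, E) : M → Type _) x₀).symmL ℝ y v)
      x := by
  set e := trivializationAt E (TangentSpace 𝓘(ℝ, E) : M → Type _) x₀
  have h : ContMDiffOn 𝓘(ℝ, E) (𝓘(ℝ, E).prod 𝓘(ℝ, E)) ∞
      (fun y ↦ TotalSpace.mk' E (E := (TangentSpace 𝓘(ℝ, E) : M → Type _)) y (e.symmL ℝ y v))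
      e.baseSet := by
    rw [e.contMDiffOn_section_baseSet_iff]
    refine (contMDiffOn_const (c := v)).congr fun y hy ↦ ?_
    simp [hy]
  exact h.contMDiffAt (e.open_baseSet.mem_nhds hx)

theorem contMDiffAt_dirDeriv {f : M → ℝ} (hf : ContMDiffAt 𝓘(ℝ, E) 𝓘(ℝ, ℝ) ∞ f x)
    (hX : SmoothAt X x) :
    ContMDiffAt 𝓘(ℝ, E) 𝓘(ℝ, ℝ) ∞ (fun y ↦ dirDeriv f y (X y)) x := by
  have h := hf.mfderiv_const (m := ∞) (by simp)
  have h2 := ContMDiffAt.clm_apply_of_inCoordinates (b₁ := id) (b₂ := f)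
    (E₁ := (TangentSpace 𝓘(ℝ, E) : M → Type _)) (E₂ := (TangentSpace 𝓘(ℝ, ℝ) : ℝ → Type _))
    (F₁ := E) (F₂ := ℝ) (IB₁ := 𝓘(ℝ, E)) (IB₂ := 𝓘(ℝ, ℝ)) h hX hf
  rw [contMDiffAt_totalSpace] at h2
  have h3 := h2.2
  simpa [dirDeriv] using! h3

theorem SmoothAt.bracket [CompleteSpace E] (hX : SmoothAt X x) (hY : SmoothAt Y x) :
    SmoothAt (bracket X Y) x := by
  have : IsManifold 𝓘(ℝ, E) (((⊤ : ℕ∞) : ℕ∞ω) + 1) M := by simpa using! ‹IsManifold 𝓘(ℝ, E) ∞ M›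
  have : IsManifold 𝓘(ℝ, E) (minSmoothness ℝ 2) M := by
    rw [minSmoothness_of_isRCLikeNormedField]; infer_instance
  exact ContMDiffAt.mlieBracket_vectorField (m := ⊤) (n := ⊤) hX hY (by simp)

theorem contMDiffAt_koszul [CompleteSpace E]
    (g : ContMDiffRiemannianMetric 𝓘(ℝ, E) ∞ E (TangentSpace 𝓘(ℝ, E) : M → Type _))
    (hY : SmoothAt Y x) (hX : SmoothAt X x) (hZ : SmoothAt Z x) :
    ContMDiffAt 𝓘(ℝ, E) 𝓘(ℝ, ℝ) ∞ (koszul g Y X Z) x :=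
  (((((contMDiffAt_dirDeriv (contMDiffAt_inner g hY hZ) hX).add
    (contMDiffAt_dirDeriv (contMDiffAt_inner g hX hZ) hY)).sub
    (contMDiffAt_dirDeriv (contMDiffAt_inner g hX hY) hZ)).add
    (contMDiffAt_inner g (hX.bracket hY) hZ)).sub
    (contMDiffAt_inner g (hX.bracket hZ) hY)).sub
    (contMDiffAt_inner g (hY.bracket hZ) hX)

end SmoothCoordinates

/-! ### Smoothness of the Levi-Civita connection -/

section SmoothLeviCivita

variable {E : Type*} [NormedAddCommGroup E] [NormedSpace ℝ E]
  {M : Type*} [TopologicalSpace M] [ChartedSpace E M] [IsManifold 𝓘(ℝ, E) ∞ M]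
  (g : ContMDiffRiemannianMetric 𝓘(ℝ, E) ∞ E (TangentSpace 𝓘(ℝ, E) : M → Type _))

/-- The bilinear form `g(A ·, ·)` read in the trivialization at `x₀`. -/
def coordForm (x₀ x : M) (A : TangentSpace 𝓘(ℝ, E) x →L[ℝ] TangentSpace 𝓘(ℝ, E) x) :
    E →L[ℝ] E →L[ℝ] ℝ :=
  let s := (trivializationAt E (TangentSpace 𝓘(ℝ, E) : M → Type _) x₀).symmL ℝ x
  s.precomp ℝ ∘L g.inner x ∘L A ∘L s

theorem coordForm_apply (x₀ x : M) (A : TangentSpace 𝓘(ℝ, E) x →L[ℝ] TangentSpace 𝓘(ℝ, E) x)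
    (v w : E) :
    coordForm g x₀ x A v w = g.inner x
      (A ((trivializationAt E (TangentSpace 𝓘(ℝ, E) : M → Type _) x₀).symmL ℝ x v))
      ((trivializationAt E (TangentSpace 𝓘(ℝ, E) : M → Type _) x₀).symmL ℝ x w) := rfl

variable [FiniteDimensional ℝ E]

theorem isInvertible_coordForm {x₀ x : M}
    (hx : x ∈ (trivializationAt E (TangentSpace 𝓘(ℝ, E) : M → Type _) x₀).baseSet) :
    (coordForm g x₀ x (.id ℝ _)).IsInvertible := by
  refine isInvertible_of_pos fun v hv ↦ ?_
  rw [coordForm_apply]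
  refine g.pos x _ fun h ↦ hv ?_
  have := congrArg
    ((trivializationAt E (TangentSpace 𝓘(ℝ, E) : M → Type _) x₀).continuousLinearMapAt ℝ x) h
  simpa [Trivialization.continuousLinearMapAt_symmL _ hx] using! this

/-- The form `g(A ·, ·)` is the Gram form composed with the coordinate expression of `A`, and the
Gram form is invertible. Smoothness of `A` thus reduces to that of two bilinear forms. -/
theorem inCoordinates_eq {x₀ x : M}
    (hx : x ∈ (trivializationAt E (TangentSpace 𝓘(ℝ, E) : M → Type _) x₀).baseSet)
    (A : TangentSpace 𝓘(ℝ, E) x →L[ℝ] TangentSpace 𝓘(ℝ, E) x) :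
    ContinuousLinearMap.inCoordinates E (TangentSpace 𝓘(ℝ, E) : M → Type _) E
      (TangentSpace 𝓘(ℝ, E) : M → Type _) x₀ x x₀ x A
      = (coordForm g x₀ x (.id ℝ _)).inverse ∘L coordForm g x₀ x A := by
  have h : coordForm g x₀ x A = coordForm g x₀ x (.id ℝ _) ∘L
      ContinuousLinearMap.inCoordinates E (TangentSpace 𝓘(ℝ, E) : M → Type _) E
      (TangentSpace 𝓘(ℝ, E) : M → Type _) x₀ x x₀ x A := by
    ext v w
    simp only [ContinuousLinearMap.comp_apply, coordForm_apply, ContinuousLinearMap.inCoordinates,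
      ContinuousLinearMap.id_apply]
    rw [Trivialization.symmL_continuousLinearMapAt _ hx]
  ext v
  rw [h, ContinuousLinearMap.comp_apply, ContinuousLinearMap.comp_apply,
    (isInvertible_coordForm g hx).inverse_apply_self]

theorem isSmoothConnection_leviCivita : IsSmoothConnection (leviCivita g) := by
  have : CompleteSpace E := FiniteDimensional.complete ℝ E
  refine ⟨⟨fun {Y} hY ↦ ?_⟩⟩
  replace hY (x : M) : SmoothAt Y x := by
    rw [contMDiffOn_univ] at hY
    exact (hY x).of_le (by simp)
  rw [contMDiffOn_univ]
  intro x₀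
  rw [contMDiffAt_hom_bundle]
  refine ⟨contMDiffAt_id, ?_⟩
  set e := trivializationAt E (TangentSpace 𝓘(ℝ, E) : M → Type _) x₀ with he
  have hx₀ : x₀ ∈ e.baseSet := FiberBundle.mem_baseSet_trivializationAt' x₀
  have hev : ∀ᶠ x in nhds x₀, x ∈ e.baseSet := e.open_baseSet.mem_nhds hx₀
  have h1 : ContMDiffAt 𝓘(ℝ, E) 𝓘(ℝ, E →L[ℝ] E →L[ℝ] ℝ) ∞
      (fun x ↦ coordForm g x₀ x (.id ℝ _)) x₀ :=
    contMDiffAt_clm_of_apply fun v ↦ contMDiffAt_clm_of_apply fun w ↦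
      contMDiffAt_inner g (smoothAt_symm hx₀ v) (smoothAt_symm hx₀ w)
  have h2 : ContMDiffAt 𝓘(ℝ, E) 𝓘(ℝ, E →L[ℝ] E →L[ℝ] ℝ) ∞
      (fun x ↦ coordForm g x₀ x (leviCivita g Y x)) x₀ := by
    refine contMDiffAt_clm_of_apply fun v ↦ contMDiffAt_clm_of_apply fun w ↦ ?_
    have hk := contMDiffAt_koszul g (hY x₀) (smoothAt_symm hx₀ v) (smoothAt_symm hx₀ w)
    -- On the frame, `g(∇_v Y, w)` is half the Koszul expression, which is smooth.
    refine ((contMDiffAt_const (c := (1 / 2 : ℝ))).mul hk).congr_of_eventuallyEq ?_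
    filter_upwards [hev] with x hx
    rw [coordForm_apply]
    have := inner_leviCivita g (smoothAt_symm hx v).diffAt (hY x).diffAt
      (smoothAt_symm hx w).diffAt
    rw [Pi.mul_apply, ← this]
    ring
  have h3 : ContMDiffAt 𝓘(ℝ, E) 𝓘(ℝ, (E →L[ℝ] ℝ) →L[ℝ] E) ∞
      (fun x ↦ (coordForm g x₀ x (.id ℝ _)).inverse) x₀ := by
    obtain ⟨G, hG⟩ := isInvertible_coordForm g hx₀
    -- Inversion of continuous linear maps is smooth near an invertible one.
    have hi := contDiffAt_map_inverse (n := ∞) G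
    rw [hG] at hi
    exact hi.contMDiffAt.comp x₀ h1
  refine (h3.clm_comp h2).congr_of_eventuallyEq ?_
  filter_upwards [hev] with x hx
  exact inCoordinates_eq g hx _

theorem isLeviCivita_leviCivita : IsLeviCivita g (leviCivita g) :=
  ⟨isSmoothConnection_leviCivita g, isTorsionFree_leviCivita g, areDual_leviCivita g⟩

end SmoothLeviCivita

end

end AlmostKahler

theorem mainTheorem7 {E : Type*} [NormedAddCommGroup E] [NormedSpace ℝ E] [FiniteDimensional ℝ E]
    {M : Type*} [TopologicalSpace M] [ChartedSpace E M] [IsManifold 𝓘(ℝ, E) ∞ M]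
    [T2Space M] [SecondCountableTopology M] (S : AlmostKahler.AlmostKahlerStructure E M) :
    List.TFAE [AlmostKahler.IsStatistical S, AlmostKahler.LeviCivitaCurvatureCommutes S,
      AlmostKahler.IsKahler S] := by
  tfae_have 1 → 3 := AlmostKahler.isKahler_of_isStatistical
  tfae_have 2 → 3 := AlmostKahler.isKahler_of_leviCivitaCurvatureCommutes
  tfae_have 3 → 1 :=
    AlmostKahler.isStatistical_of_isKahler (AlmostKahler.isLeviCivita_leviCivita S.g)
  tfae_have 3 → 2 :=
    AlmostKahler.leviCivitaCurvatureCommutes_of_isKahler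
      (AlmostKahler.isLeviCivita_leviCivita S.g)
  tfae_finish
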